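/- Let $V$ be a complex vector space of finite dimension $n$, let $1\le k\le n$, and let $G(k,n)\subset\mathbb P(\Lambda^kV)=\mathbb P^{N-1}$, $N=\binom nk$, be the Grassmannian of $k$-dimensional subspaces of $V$ in its Plücker embedding. Let $Y_1,\dots,Y_l\subset\mathbb P^{N-1}$ ($l\ge 0$) be hypersurfaces, $Y_i$ being the zero locus of a nonzero homogeneous polynomial of degree $d_i\ge 1$, put $X=G(k,n)\cap Y_1\cap\dots\cap Y_l$, and let $x\in X$. Let $\mathbb P_x^{N-2}=\mathbb P(T_x\mathbb P^{N-1})$ be the projectivized tangent space of $\mathbb P^{N-1}$ at $x$. For $Z\subseteq\mathbb P^{N-1}$ let $B_Z(x)\subseteq\mathbb P_x^{N-2}$ be the base of the family of lines through $x$ on $Z$, that is, the set of tangent directions at $x$ of the projective lines $M$ with $x\in M\subseteq Z$. Then: 1. $B_{G(k,n)}(x)$ is a Segre variety $\mathbb P^{k-1}\times\mathbb P^{n-k-1}$: it is the image of the Segre variety in $\mathbb P(\mathbb C^k\otimes\mathbb C^{n-k})$ under a linear embedding into $\mathbb P_x^{N-2}$ (it is empty if $k=n$). 2. There are $\sum_i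 d_i$ hypersurfaces $H_j$ in $\mathbb P_x^{N-2}$ (not necessarily distinct), each the zero locus of a nonzero homogeneous polynomial of some degree $e_j$ with $1\le e_j\le\max_i d_i$, such that $$B_X(x)=B_{G(k,n)}(x)\cap\bigcap_j H_j .$$ So $B_X(x)$ is, as a set (equivalently, as a reduced scheme), the intersection of $\mathbb P^{k-1}\times\mathbb P^{n-k-1}$ with $\sum_i d_i$ hypersurfaces of degree at most $\max_i d_i$. In particular this applies to every member $X_m\subset G(k_m,n_m)$ of a complete intersection $\mathbf X=\varinjlim X_m$ in a linear ind-Grassmannian and every $x\in X_m$. -/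

import Mathlib

open scoped TensorProduct

noncomputable section

/-! ### Projective geometry over the complex numbers

`ℙ ℂ E` (`Projectivization ℂ E`) is the projective space of one-dimensional subspaces of `E`.
Reduced closed subschemes of it are identified with their sets of points. -/

/-- `Z` is a hypersurface of degree `d ≥ 1` in `ℙ(E)`: in homogeneous coordinates with respect to
some basis of `E` it is the zero locus of a nonzero homogeneous polynomial of degree `d`. -/
def IsHypersurface {E : Type*} [AddCommGroup E] [Module ℂ E] (d : ℕ)
    (Z : Set (Projectivization ℂ E)) : Prop :=
  1 ≤ d ∧ ∃ (b : Module.Basis (Fin (Module.finrank ℂ E)) ℂ E)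
    (F : MvPolynomial (Fin (Module.finrank ℂ E)) ℂ),
    F ≠ 0 ∧ F.IsHomogeneous d ∧
      Z = {p | ∀ v ∈ p.submodule, MvPolynomial.eval (fun i => b.repr v i) F = 0}

/-- A projective line in `ℙ(E)`: a subset that is the image of an embedding of the projective line
`ℙ(ℂ²)` pulling back `𝒪(1)` to `𝒪(1)`, i.e. of an embedding given by linear forms. -/
def IsProjectiveLine {E : Type*} [AddCommGroup E] [Module ℂ E]
    (M : Set (Projectivization ℂ E)) : Prop :=
  ∃ (f : (Fin 2 → ℂ) →ₗ[ℂ] E) (hf : Function.Injective f),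
    M = Set.range (Projectivization.map f hf)

/-- The tangent space `T_x ℙ(E) = Hom(x, E / x)`, where `x` is regarded as a one-dimensional
subspace of `E`. -/
abbrev ProjTangentSpace {E : Type*} [AddCommGroup E] [Module ℂ E]
    (x : Projectivization ℂ E) : Type _ :=
  x.submodule →ₗ[ℂ] (E ⧸ x.submodule)

/-- The subspace of `E` spanned by (the cone over) a subset of `ℙ(E)`. -/
def linearHull {E : Type*} [AddCommGroup E] [Module ℂ E]
    (M : Set (Projectivization ℂ E)) : Submodule ℂ E :=
  ⨆ p ∈ M, p.submodule

/-- The tangent space at `x ∈ M` of a linearly embedded projective space `M = ℙ(L) ⊆ ℙ(E)`: the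
subspace `Hom(x, L / x)` of `Hom(x, E / x)`. -/
def tangentOfLinear {E : Type*} [AddCommGroup E] [Module ℂ E]
    (M : Set (Projectivization ℂ E)) (x : Projectivization ℂ E) :
    Submodule ℂ (ProjTangentSpace x) where
  carrier := {φ | ∀ v, φ v ∈ (linearHull M).map x.submodule.mkQ}
  add_mem' := fun ha hb v => Submodule.add_mem _ (ha v) (hb v)
  zero_mem' := fun _ => Submodule.zero_mem _
  smul_mem' := fun c _ ha v => Submodule.smul_mem _ c (ha v)

/-- The base of the family of lines through `x` on `X ⊆ ℙ(E)`: a line `M` with `x ∈ M ⊆ X` is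
recorded by its tangent direction at `x`, a point of the projectivized tangent space of `ℙ(E)`
at `x`. -/
def baseOfLines {E : Type*} [AddCommGroup E] [Module ℂ E]
    (X : Set (Projectivization ℂ E)) (x : Projectivization ℂ E) :
    Set (Projectivization ℂ (ProjTangentSpace x)) :=
  {t | ∃ M : Set (Projectivization ℂ E),
    IsProjectiveLine M ∧ x ∈ M ∧ M ⊆ X ∧ t.submodule = tangentOfLinear M x}

/-- `S` is a Segre variety `ℙ(ℂᵃ) × ℙ(ℂᵇ) = ℙ^{a-1} × ℙ^{b-1}` in `ℙ(T)`: the image of the Segre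
variety `{[u ⊗ v]} ⊆ ℙ(ℂᵃ ⊗ ℂᵇ)` under a linear embedding `ℙ(ℂᵃ ⊗ ℂᵇ) ↪ ℙ(T)`. -/
def IsSegreVariety {T : Type*} [AddCommGroup T] [Module ℂ T] (a b : ℕ)
    (S : Set (Projectivization ℂ T)) : Prop :=
  ∃ σ : ((Fin a → ℂ) ⊗[ℂ] (Fin b → ℂ)) →ₗ[ℂ] T, Function.Injective σ ∧
    S = {t | ∃ (u : Fin a → ℂ) (v : Fin b → ℂ), u ≠ 0 ∧ v ≠ 0 ∧
      t.submodule = Submodule.span ℂ {σ (u ⊗ₜ[ℂ] v)}}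

/-! ### The Grassmannian in its Plücker embedding -/

/-- For a `k`-dimensional subspace `W ⊆ V` the subspace `⋀ᵏ W ⊆ ⋀ᵏ V` is one-dimensional. -/
theorem finrank_range_exteriorPower_map {V : Type*} [AddCommGroup V] [Module ℂ V]
    [FiniteDimensional ℂ V] {k : ℕ} (W : Submodule ℂ V) (hW : Module.finrank ℂ W = k) :
    Module.finrank ℂ (LinearMap.range (exteriorPower.map k W.subtype)) = 1 := by
  rw [LinearMap.finrank_range_of_inj
    (exteriorPower.map_injective_field W.injective_subtype),
    exteriorPower.finrank_eq, hW, Nat.choose_self]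

/-- The Plücker map `W ↦ ⋀ᵏ W ∈ ℙ(⋀ᵏ V)` on the `k`-dimensional subspaces of `V`. -/
def pluckerMap (V : Type*) [AddCommGroup V] [Module ℂ V] [FiniteDimensional ℂ V] (k : ℕ)
    (W : {W : Submodule ℂ V // Module.finrank ℂ W = k}) : Projectivization ℂ (⋀[ℂ]^k V) :=
  Projectivization.mk'' (LinearMap.range (exteriorPower.map k W.1.subtype))
    (finrank_range_exteriorPower_map W.1 W.2)

/-- The Grassmannian `G(k, V)` of `k`-dimensional subspaces of `V` as a subvariety of the Plücker
space `ℙ(⋀ᵏ V)`. -/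
def grassmannian (V : Type*) [AddCommGroup V] [Module ℂ V] [FiniteDimensional ℂ V] (k : ℕ) :
    Set (Projectivization ℂ (⋀[ℂ]^k V)) :=
  Set.range (pluckerMap V k)

end

/-! Fix a vector x₀ spanning x. A tangent direction at x is a class y mod x, and it lies in B_Z(x)
exactly when the line through x₀ and y lies in Z (`mem_baseOfLines_iff`). Hence B_Z(x) commutes with
intersections in Z, and the Grassmannian and each hypersurface can be treated separately.

For Y = {F = 0} of degree d, restrict F to the affine chart x₀ + (complement of x). The line lies in
Y exactly when all homogeneous components P_0, …, P_d of the restriction vanish at y, and P_0 =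
F(x₀) = 0. The other d components give the hypersurfaces (`exists_hypersurfaces_baseOfLines`).

For the Grassmannian write k = m + 1 and x = ⋀ᵏW. If the line lies on G, the k-spaces of x₀ and y
meet in dimension at least m, so y = w ∧ a with a ∈ ⋀ᵐW (`exists_eq_ι_mul_of_add_mem_wedgePower`).
Conversely every a ∈ ⋀ᵐW is decomposable, because ⋀ᵐW is dual to W up to a twist, so w ∧ a spans
with x₀ a pencil on G (`exists_mem_wedgePower_of_mem_pencil`). Modulo x only w mod W matters, and
⋀ᵐW ⊗ V/W embeds in ⋀ᵏV / x (`eq_zero_of_sum_wedge_mem`): these are the two Segre factors. -/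

noncomputable section

/-! ### Lines through a point and their tangent directions. -/

section Lines

variable {E : Type*} [AddCommGroup E] [Module ℂ E]

theorem Projectivization.mem_range_map_iff {F : Type*} [AddCommGroup F] [Module ℂ F]
    (f : F →ₗ[ℂ] E) (hf : Function.Injective f) (p : Projectivization ℂ E) :
    p ∈ Set.range (Projectivization.map f hf) ↔ p.submodule ≤ LinearMap.range f := by
  constructor
  · rintro ⟨q, rfl⟩
    induction q with | h v hv =>
    rw [Projectivization.map_mk, Projectivization.submodule_mk, Submodule.span_singleton_le_iff_mem]
    exact ⟨v, rfl⟩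
  · induction p with | h v hv =>
    rw [Projectivization.submodule_mk, Submodule.span_singleton_le_iff_mem]
    rintro ⟨u, rfl⟩
    have hu : u ≠ 0 := by rintro rfl; simp at hv
    exact ⟨Projectivization.mk ℂ u hu, by rw [Projectivization.map_mk]⟩

theorem linearHull_range_map {F : Type*} [AddCommGroup F] [Module ℂ F]
    (f : F →ₗ[ℂ] E) (hf : Function.Injective f) :
    linearHull (Set.range (Projectivization.map f hf)) = LinearMap.range f := by
  apply le_antisymm
  · exact iSup₂_le fun p hp => (Projectivization.mem_range_map_iff f hf p).1 hp
  · rintro _ ⟨u, rfl⟩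
    by_cases hu : u = 0
    · simp [hu]
    have hfu : f u ≠ 0 := by simpa using hf.ne hu
    refine (le_iSup₂_of_le (f := fun p (_ : p ∈ Set.range (Projectivization.map f hf)) =>
      p.submodule) (Projectivization.mk ℂ (f u) hfu) ?_ le_rfl : _ ≤ _)
      (Submodule.mem_span_singleton_self (f u))
    exact ⟨Projectivization.mk ℂ u hu, by rw [Projectivization.map_mk]⟩

/-- Evaluation at a nonzero vector `x₀` of the line `x` identifies `Hom(x, E / x)` with `E / x`. -/
def tangentEquiv (x : Projectivization ℂ E) (x₀ : E) (hx : x.submodule = ℂ ∙ x₀) (h0 : x₀ ≠ 0) :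
    ProjTangentSpace x ≃ₗ[ℂ] (E ⧸ x.submodule) :=
  (((LinearEquiv.toSpanNonzeroSingleton ℂ E x₀ h0).trans
    (LinearEquiv.ofEq _ _ hx.symm)).congrLeft (E ⧸ x.submodule) ℂ).symm.trans
    (LinearMap.ringLmapEquivSelf ℂ ℂ (E ⧸ x.submodule))

theorem tangentEquiv_apply (x : Projectivization ℂ E) (x₀ : E) (hx : x.submodule = ℂ ∙ x₀)
    (h0 : x₀ ≠ 0) (φ : ProjTangentSpace x) :
    tangentEquiv x x₀ hx h0 φ = φ ⟨x₀, hx ▸ Submodule.mem_span_singleton_self x₀⟩ := by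
  simp only [tangentEquiv, LinearEquiv.trans_apply]
  change φ _ = _
  congr 1
  ext
  simp

theorem mem_tangentOfLinear_iff (x : Projectivization ℂ E) (x₀ : E) (hx : x.submodule = ℂ ∙ x₀)
    (h0 : x₀ ≠ 0) (M : Set (Projectivization ℂ E)) (φ : ProjTangentSpace x) :
    φ ∈ tangentOfLinear M x ↔
      tangentEquiv x x₀ hx h0 φ ∈ (linearHull M).map x.submodule.mkQ := by
  rw [tangentEquiv_apply]
  constructor
  · exact fun h => h _
  · rintro h ⟨v, hv⟩
    obtain ⟨c, rfl⟩ := Submodule.mem_span_singleton.1 (hx ▸ hv)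
    have : (⟨c • x₀, hv⟩ : x.submodule) =
      c • ⟨x₀, hx ▸ Submodule.mem_span_singleton_self x₀⟩ := rfl
    rw [this, map_smul]
    exact Submodule.smul_mem _ _ h

/-- A line through x with direction y mod x can only be the one spanned by x₀ and y, so the
existential over lines becomes a condition on one explicit plane. -/
theorem mem_baseOfLines_iff (X : Set (Projectivization ℂ E)) (x : Projectivization ℂ E) (x₀ : E)
    (hx : x.submodule = ℂ ∙ x₀) (h0 : x₀ ≠ 0) (φ : ProjTangentSpace x) (hφ : φ ≠ 0) (y : E)
    (hy : tangentEquiv x x₀ hx h0 φ = x.submodule.mkQ y) :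
    Projectivization.mk ℂ φ hφ ∈ baseOfLines X x ↔
      ∀ p : Projectivization ℂ E, p.submodule ≤ Submodule.span ℂ {x₀, y} → p ∈ X := by
  constructor
  · rintro ⟨M, ⟨f, hf, rfl⟩, hxM, hMX, ht⟩ p hp
    apply hMX
    rw [Projectivization.mem_range_map_iff] at hxM ⊢
    refine hp.trans ?_
    have hφm : φ ∈ tangentOfLinear (Set.range (Projectivization.map f hf)) x := by
      rw [← ht]; exact Submodule.mem_span_singleton_self φ
    rw [mem_tangentOfLinear_iff x x₀ hx h0, hy, linearHull_range_map] at hφm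
    obtain ⟨z, hz, hzy⟩ := hφm
    rw [Submodule.mkQ_apply, Submodule.mkQ_apply, Submodule.Quotient.eq] at hzy
    have hyr : y ∈ LinearMap.range f := by
      have := sub_mem hz (hxM hzy)
      rwa [sub_sub_cancel] at this
    rw [Submodule.span_le]
    rintro w (rfl | rfl)
    · exact hxM (hx ▸ Submodule.mem_span_singleton_self _)
    · exact hyr
  · intro h
    have hyx : y ∉ x.submodule := by
      intro hyx
      rw [← Submodule.Quotient.mk_eq_zero] at hyx
      rw [Submodule.mkQ_apply, hyx, LinearEquiv.map_eq_zero_iff] at hy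
      exact hφ hy
    have hli : LinearIndependent ℂ ![x₀, y] := by
      rw [LinearIndependent.pair_iff' h0]
      rintro a rfl
      exact hyx (hx ▸ Submodule.smul_mem _ _ (Submodule.mem_span_singleton_self _))
    have hinj : Function.Injective (Fintype.linearCombination ℂ ![x₀, y]) :=
      hli.fintypeLinearCombination_injective
    have hr : LinearMap.range (Fintype.linearCombination ℂ ![x₀, y]) =
        Submodule.span ℂ {x₀, y} := by
      rw [Fintype.range_linearCombination]; simp [Set.pair_comm]
    refine ⟨_, ⟨_, hinj, rfl⟩, ?_, ?_, ?_⟩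
    · rw [Projectivization.mem_range_map_iff, hr, hx, Submodule.span_singleton_le_iff_mem]
      exact Submodule.subset_span (by simp)
    · intro p hp
      rw [Projectivization.mem_range_map_iff, hr] at hp
      exact h p hp
    · ext ψ
      have hx0 : x.submodule.mkQ x₀ = 0 := by
        rw [Submodule.mkQ_apply, Submodule.Quotient.mk_eq_zero, hx]
        exact Submodule.mem_span_singleton_self _
      rw [mem_tangentOfLinear_iff x x₀ hx h0, linearHull_range_map, hr, Submodule.map_span,
        Set.image_pair, hx0, Submodule.span_insert_zero, ← hy, Projectivization.submodule_mk,
        Submodule.mem_span_singleton, Submodule.mem_span_singleton]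
      simp only [← map_smul, EmbeddingLike.apply_eq_iff_eq]

/-- The set S is the unique line with direction t. It does not depend on X, which is why the base of
lines commutes with intersections. -/
theorem exists_mem_baseOfLines_iff_subset (x : Projectivization ℂ E)
    (t : Projectivization ℂ (ProjTangentSpace x)) :
    ∃ S : Set (Projectivization ℂ E), ∀ X, t ∈ baseOfLines X x ↔ S ⊆ X := by
  induction t with | h φ hφ =>
  have hx := x.submodule_eq
  obtain ⟨y, hy⟩ := x.submodule.mkQ_surjective (tangentEquiv x _ hx x.rep_nonzero φ)
  exact ⟨{p | p.submodule ≤ Submodule.span ℂ {x.rep, y}}, fun X =>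
    mem_baseOfLines_iff X x _ hx x.rep_nonzero φ hφ y hy.symm⟩

theorem baseOfLines_inter (X Y : Set (Projectivization ℂ E)) (x : Projectivization ℂ E) :
    baseOfLines (X ∩ Y) x = baseOfLines X x ∩ baseOfLines Y x := by
  ext t
  obtain ⟨S, hS⟩ := exists_mem_baseOfLines_iff_subset x t
  simp [hS]

theorem baseOfLines_iInter {ι : Sort*} (Y : ι → Set (Projectivization ℂ E))
    (x : Projectivization ℂ E) : baseOfLines (⋂ i, Y i) x = ⋂ i, baseOfLines (Y i) x := by
  ext t
  obtain ⟨S, hS⟩ := exists_mem_baseOfLines_iff_subset x t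
  simp [hS]

end Lines

/-! ### Lines through a point on a hypersurface. -/

section Hypersurfaces

open MvPolynomial

theorem MvPolynomial.exists_polynomial_eval_eq_eval_add_smul {ι : Type*} (F : MvPolynomial ι ℂ)
    (p q : ι → ℂ) : ∃ r : Polynomial ℂ, ∀ s : ℂ, r.eval s = eval (p + s • q) F := by
  refine ⟨aeval (fun i => Polynomial.C (p i) + Polynomial.X * Polynomial.C (q i)) F, fun s => ?_⟩
  rw [← Polynomial.coe_evalRingHom, aeval_def, eval₂_eq, eval_eq, map_sum]
  simp [Polynomial.eval_prod]
  simp only [mul_comm s]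

theorem Polynomial.eval_zero_of_forall_ne_zero (r : Polynomial ℂ)
    (h : ∀ s : ℂ, s ≠ 0 → r.eval s = 0) : r.eval 0 = 0 := by
  have : r = 0 := Polynomial.eq_zero_of_infinite_isRoot r
    (Set.Infinite.mono (fun s (hs : s ∈ ({0} : Set ℂ)ᶜ) => h s hs)
      (Set.finite_singleton 0).infinite_compl)
  simp [this]

theorem MvPolynomial.IsHomogeneous.eval_smul {ι : Type*} {F : MvPolynomial ι ℂ} {d : ℕ}
    (hF : F.IsHomogeneous d) (c : ℂ) (v : ι → ℂ) : eval (c • v) F = c ^ d * eval v F := by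
  rw [eval_eq, eval_eq, Finset.mul_sum]
  refine Finset.sum_congr rfl fun m hm => ?_
  have := hF.degree_eq_sum_deg_support hm
  simp only [Pi.smul_apply, smul_eq_mul, mul_pow, Finset.prod_mul_distrib, Finset.prod_pow_eq_pow_sum]
  rw [this]
  ring

/-- A homogeneous polynomial that vanishes on the affine line `p + ℂ q` vanishes on the plane
spanned by `p` and `q`. -/
theorem MvPolynomial.IsHomogeneous.eval_smul_add_smul_eq_zero {ι : Type*} {F : MvPolynomial ι ℂ}
    {d : ℕ} (hF : F.IsHomogeneous d) {p q : ι → ℂ} (h : ∀ s : ℂ, eval (p + s • q) F = 0)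
    (a b : ℂ) : eval (a • p + b • q) F = 0 := by
  have key : ∀ c : ℂ, c ≠ 0 → eval (b • q + c • p) F = 0 := fun c hc => by
    have : b • q + c • p = c • (p + (c⁻¹ * b) • q) := by
      rw [smul_add, smul_smul, mul_inv_cancel_left₀ hc, add_comm]
    rw [this, hF.eval_smul, h, mul_zero]
  by_cases ha : a = 0
  -- The point q at infinity of the affine line is the limit c → 0 of b q + c p.
  · obtain ⟨r, hr⟩ := exists_polynomial_eval_eq_eval_add_smul F (b • q) p
    have := Polynomial.eval_zero_of_forall_ne_zero r fun s hs => by rw [hr, key s hs]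
    rw [hr] at this
    rw [ha, add_comm]
    exact this
  · rw [add_comm, key a ha]

/-- Along the line through 0 and v, P is a polynomial in s whose coefficient of s ^ j is the degree
j component at v. -/
theorem MvPolynomial.eval_smul_eq_zero_iff_homogeneousComponent {ι : Type*}
    (P : MvPolynomial ι ℂ) {d : ℕ} (hP : P.totalDegree ≤ d) (v : ι → ℂ) :
    (∀ s : ℂ, eval (s • v) P = 0) ↔ ∀ j ≤ d, eval v (homogeneousComponent j P) = 0 := by
  have hsum : ∀ s : ℂ, eval (s • v) P =
      ∑ j ∈ Finset.range (d + 1), s ^ j * eval v (homogeneousComponent j P) := fun s => by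
    have : P = ∑ j ∈ Finset.range (d + 1), homogeneousComponent j P := by
      conv_lhs => rw [← sum_homogeneousComponent P]
      refine Finset.sum_subset (by simpa using hP) fun j _ hj => ?_
      exact homogeneousComponent_eq_zero _ _ (by simpa using hj)
    conv_lhs => rw [this]
    rw [map_sum]
    exact Finset.sum_congr rfl fun j _ =>
      (homogeneousComponent_isHomogeneous j P).eval_smul s v
  constructor
  · intro h j hj
    set r : Polynomial ℂ := ∑ j ∈ Finset.range (d + 1),
      Polynomial.monomial j (eval v (homogeneousComponent j P)) with hr
    have h0 : r = 0 := Polynomial.funext fun s => by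
      rw [hr, Polynomial.eval_finsetSum, Polynomial.eval_zero, ← h s, hsum]
      exact Finset.sum_congr rfl fun j _ => by rw [Polynomial.eval_monomial, mul_comm]
    have := congrArg (fun q => q.coeff j) h0
    simpa [hr, Polynomial.finsetSum_coeff, Polynomial.coeff_monomial, Nat.lt_succ_iff.2 hj]
      using this
  · intro h s
    rw [hsum]
    exact Finset.sum_eq_zero fun j hj => by
      rw [h j (Nat.lt_succ_iff.1 (Finset.mem_range.1 hj)), mul_zero]

variable {E : Type*} [AddCommGroup E] [Module ℂ E] [FiniteDimensional ℂ E]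

/-- Substitution of an affine parametrization into a polynomial does not raise its degree. -/
theorem MvPolynomial.exists_eval_eq_eval_affine {ι κ : Type*} [Fintype κ] (F : MvPolynomial ι ℂ)
    (p : ι → ℂ) (A : (κ → ℂ) →ₗ[ℂ] (ι → ℂ)) :
    ∃ P : MvPolynomial κ ℂ, P.totalDegree ≤ F.totalDegree ∧ ∀ v, eval v P = eval (p + A v) F := by
  classical
  let g : ι → MvPolynomial κ ℂ := fun i => C (p i) + ∑ m, C (A (Pi.single m 1) i) * X m
  have hg : ∀ i, (g i).totalDegree ≤ 1 := fun i => by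
    refine (totalDegree_add _ _).trans (max_le (by simp) ?_)
    refine totalDegree_finsetSum_le fun m _ => ?_
    exact (isHomogeneous_C_mul_X _ _).totalDegree_le
  have hge : ∀ i v, eval v (g i) = p i + A v i := fun i v => by
    have : A v = ∑ m, v m • A (Pi.single m 1) := by
      conv_lhs => rw [pi_eq_sum_univ' v]
      simp
    simp [g, this, Finset.sum_apply, mul_comm]
  refine ⟨bind₁ g F, ?_, fun v => ?_⟩
  · rw [bind₁, aeval_def, eval₂_eq]
    refine totalDegree_finsetSum_le fun m hm => ?_
    refine (totalDegree_mul _ _).trans ?_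
    rw [algebraMap_eq, totalDegree_C, zero_add]
    refine (totalDegree_finsetProd _ _).trans ?_
    refine le_trans (Finset.sum_le_sum fun i _ => ?_) (le_totalDegree hm)
    refine (totalDegree_pow _ _).trans ?_
    exact (Nat.mul_le_mul_left _ (hg i)).trans_eq (mul_one _)
  · have hpt : p + A v = fun i => eval v (g i) := _root_.funext fun i => (hge i v).symm
    rw [hpt]
    exact eval₂Hom_bind₁ (RingHom.id ℂ) v g F

theorem exists_hypersurfaces_baseOfLines (Y : Set (Projectivization ℂ E)) (d : ℕ)
    (hY : IsHypersurface d Y) (x : Projectivization ℂ E) (hx : x ∈ Y) :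
    ∃ (e : Fin d → ℕ) (H : Fin d → Set (Projectivization ℂ (ProjTangentSpace x))),
      (∀ j, IsHypersurface (e j) (H j) ∧ e j ≤ d) ∧ baseOfLines Y x = ⋂ j, H j := by
  obtain ⟨hd, b, F, hF0, hF, rfl⟩ := hY
  set x₀ := x.rep
  have h0 : x₀ ≠ 0 := x.rep_nonzero
  have hx₀ : x.submodule = ℂ ∙ x₀ := x.submodule_eq
  have hmem₀ : x₀ ∈ x.submodule := hx₀ ▸ Submodule.mem_span_singleton_self x₀
  obtain ⟨s, hs⟩ := x.submodule.mkQ.exists_rightInverse_of_surjective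
    (LinearMap.range_eq_top.2 x.submodule.mkQ_surjective)
  -- L lifts tangent vectors linearly to E, so x₀ + L φ parametrizes an affine chart around x; P
  -- below is F in this chart.
  let L : ProjTangentSpace x →ₗ[ℂ] E := s ∘ₗ (tangentEquiv x x₀ hx₀ h0).toLinearMap
  have hL : ∀ φ, tangentEquiv x x₀ hx₀ h0 φ = x.submodule.mkQ (L φ) := fun φ =>
    (LinearMap.congr_fun hs _).symm
  let c := Module.finBasis ℂ (ProjTangentSpace x)
  obtain ⟨P, hPdeg, hP⟩ := exists_eval_eq_eval_affine F (b.equivFun x₀)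
    (b.equivFun.toLinearMap ∘ₗ L ∘ₗ c.equivFun.symm.toLinearMap)
  replace hP : ∀ φ (s : ℂ), eval (s • c.equivFun φ) P =
      eval (b.equivFun x₀ + s • b.equivFun (L φ)) F := fun φ s => by
    rw [hP]; simp
  replace hPdeg := hPdeg.trans hF.totalDegree_le
  have hPcomp0 : homogeneousComponent 0 P = 0 := by
    rw [homogeneousComponent_zero, ← constantCoeff_eq, constantCoeff_eq, C_eq_zero]
    have h1 := hP 0 0
    rw [zero_smul, zero_smul, add_zero] at h1
    have h2 : eval (b.equivFun x₀) F = 0 := hx x₀ hmem₀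
    rw [h2] at h1
    rw [← constantCoeff_eq, ← eval_zero]
    exact h1
  have hline : ∀ φ (hφ : φ ≠ 0), Projectivization.mk ℂ φ hφ ∈ baseOfLines
      {p | ∀ v ∈ p.submodule, eval (fun i => b.repr v i) F = 0} x ↔
      ∀ j ≤ d, eval (c.equivFun φ) (homogeneousComponent j P) = 0 := fun φ hφ => by
    rw [mem_baseOfLines_iff _ x x₀ hx₀ h0 φ hφ (L φ) (hL φ),
      ← eval_smul_eq_zero_iff_homogeneousComponent P hPdeg]
    simp only [hP]
    constructor
    · intro h s
      -- The zero vector is not a projective point; there F vanishes because d ≥ 1.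
      by_cases hz : x₀ + s • L φ = 0
      · rw [← map_smul, ← map_add, hz, map_zero]
        have := hF.eval_smul 0 0
        rwa [smul_zero, zero_pow (by omega), zero_mul] at this
      have := h (Projectivization.mk ℂ _ hz) (by
        rw [Projectivization.submodule_mk, Submodule.span_singleton_le_iff_mem]
        exact Submodule.mem_span_pair.2 ⟨1, s, by rw [one_smul]⟩) _
        (Submodule.mem_span_singleton_self _)
      rw [← map_smul, ← map_add]
      exact this
    · intro h p hp v hv
      obtain ⟨α, β, rfl⟩ := Submodule.mem_span_pair.1 (hp hv)
      have := hF.eval_smul_add_smul_eq_zero h α β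
      rw [← map_smul, ← map_smul, ← map_add] at this
      exact this
  -- If P were zero, F would vanish on the whole chart, hence by homogeneity on all of E.
  have hPne : ∃ j ≤ d, homogeneousComponent j P ≠ 0 := by
    by_contra! hcon
    apply hF0
    refine MvPolynomial.funext fun w => ?_
    obtain ⟨z, rfl⟩ := b.equivFun.surjective w
    let φ := (tangentEquiv x x₀ hx₀ h0).symm (x.submodule.mkQ z)
    have hφ : x.submodule.mkQ z = x.submodule.mkQ (L φ) := by
      rw [← hL, LinearEquiv.apply_symm_apply]
    rw [Submodule.mkQ_apply, Submodule.mkQ_apply, Submodule.Quotient.eq] at hφ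
    obtain ⟨a, ha⟩ := Submodule.mem_span_singleton.1 (hx₀.le hφ)
    have hz : z = a • x₀ + (1 : ℂ) • L φ := by rw [ha]; simp
    rw [hz, map_add, map_smul, map_smul, map_zero]
    refine hF.eval_smul_add_smul_eq_zero (fun s => ?_) _ _
    rw [← hP]
    refine (eval_smul_eq_zero_iff_homogeneousComponent P hPdeg _).2 (fun j hj => ?_) s
    rw [hcon j hj, map_zero]
  obtain ⟨j₀, hj₀d, hj₀⟩ := hPne
  have hj₀1 : 1 ≤ j₀ := by
    rcases Nat.eq_zero_or_pos j₀ with rfl | h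
    · exact absurd hPcomp0 hj₀
    · exact h
  classical
  -- Index j stands for degree j + 1. A zero component defines no hypersurface, so a fixed nonzero
  -- one is repeated in its place.
  let e : Fin d → ℕ := fun j => if homogeneousComponent (j + 1) P = 0 then j₀ else j + 1
  have he0 : ∀ j, homogeneousComponent (e j) P ≠ 0 := fun j => by
    by_cases h : homogeneousComponent (j + 1) P = 0 <;> simp [e, h, hj₀]
  have he : ∀ j, 1 ≤ e j ∧ e j ≤ d := fun j => by
    simp only [e]; split_ifs <;> omega
  refine ⟨e, fun j => {p | ∀ v ∈ p.submodule,
    eval (fun i => c.repr v i) (homogeneousComponent (e j) P) = 0}, fun j =>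
    ⟨⟨(he j).1, c, _, he0 j, homogeneousComponent_isHomogeneous _ _, rfl⟩, (he j).2⟩, ?_⟩
  ext t
  induction t with | h φ hφ =>
  rw [hline, Set.mem_iInter]
  have hmem : ∀ j, (Projectivization.mk ℂ φ hφ ∈ {p : Projectivization ℂ (ProjTangentSpace x) |
      ∀ v ∈ p.submodule, eval (fun i => c.repr v i) (homogeneousComponent j P) = 0}) ↔
      eval (c.equivFun φ) (homogeneousComponent j P) = 0 := fun j => by
    constructor
    · exact fun h => h φ (Submodule.mem_span_singleton_self φ)
    · intro h v hv
      obtain ⟨a, rfl⟩ := Submodule.mem_span_singleton.1 hv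
      have := (homogeneousComponent_isHomogeneous j P).eval_smul a (c.equivFun φ)
      rw [h, mul_zero, ← map_smul] at this
      exact this
  simp only [hmem]
  constructor
  · exact fun h j => h _ (he j).2
  · intro h j hj
    rcases Nat.eq_zero_or_pos j with rfl | hj1
    · rw [hPcomp0, map_zero]
    · have := h ⟨j - 1, by omega⟩
      by_cases hz : homogeneousComponent j P = 0
      · rw [hz, map_zero]
      · simpa [e, Nat.sub_add_cancel hj1, hz] using this

end Hypersurfaces

/-! ### Decomposable vectors and hyperplanes in exterior powers. -/

section ExteriorPowers

variable {V : Type*} [AddCommGroup V] [Module ℂ V]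

/-- The subspace `⋀ᵐ W` of the exterior algebra of `V`, for a subspace `W ⊆ V`. -/
def wedgePower (m : ℕ) (W : Submodule ℂ V) : Submodule ℂ (ExteriorAlgebra ℂ V) :=
  (W.map (ExteriorAlgebra.ι ℂ)) ^ m

theorem wedgePower_eq_map_exteriorPower (m : ℕ) (W : Submodule ℂ V) :
    wedgePower m W = (⋀[ℂ]^m W).map (ExteriorAlgebra.map W.subtype).toLinearMap := by
  rw [wedgePower, ExteriorAlgebra.exteriorPower, Submodule.map_pow, ExteriorAlgebra.ι_range_map_map,
    Submodule.range_subtype]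

theorem exteriorAlgebra_map_subtype_injective (W : Submodule ℂ V) :
    Function.Injective (ExteriorAlgebra.map W.subtype).toLinearMap :=
  ExteriorAlgebra.map_injective_field (Submodule.ker_subtype W)

theorem finrank_wedgePower [FiniteDimensional ℂ V] (m : ℕ) (W : Submodule ℂ V) :
    Module.finrank ℂ (wedgePower m W) = (Module.finrank ℂ W).choose m := by
  rw [wedgePower_eq_map_exteriorPower, ← exteriorPower.finrank_eq]
  exact ((Submodule.equivMapOfInjective _ (exteriorAlgebra_map_subtype_injective W)
    (⋀[ℂ]^m W)).finrank_eq).symm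

theorem wedgePower_mono (m : ℕ) {W W' : Submodule ℂ V} (h : W ≤ W') :
    wedgePower m W ≤ wedgePower m W' :=
  pow_le_pow_left' (Submodule.map_mono h) m

theorem wedgePower_le_exteriorPower (m : ℕ) (W : Submodule ℂ V) :
    wedgePower m W ≤ ⋀[ℂ]^m V :=
  pow_le_pow_left' LinearMap.map_le_range m

theorem ι_mul_mem_wedgePower {m : ℕ} {W : Submodule ℂ V} {v : V} (hv : v ∈ W)
    {z : ExteriorAlgebra ℂ V} (hz : z ∈ wedgePower m W) :
    ExteriorAlgebra.ι ℂ v * z ∈ wedgePower (m + 1) W := by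
  rw [wedgePower, pow_succ']
  exact Submodule.mul_mem_mul (Submodule.mem_map_of_mem hv) hz

instance [FiniteDimensional ℂ V] (m : ℕ) (W : Submodule ℂ V) :
    FiniteDimensional ℂ (wedgePower m W) := by
  rw [wedgePower_eq_map_exteriorPower]; infer_instance

theorem exists_ne_zero_mem_wedgePower [FiniteDimensional ℂ V] {m : ℕ} {W : Submodule ℂ V}
    (hW : m ≤ Module.finrank ℂ W) : ∃ z ∈ wedgePower m W, z ≠ 0 := by
  apply Submodule.exists_mem_ne_zero_of_ne_bot
  intro h
  have := finrank_wedgePower m W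
  rw [h, finrank_bot] at this
  exact (Nat.choose_pos hW).ne this

theorem wedgePower_eq_span [FiniteDimensional ℂ V] {m : ℕ} {W : Submodule ℂ V}
    (hW : Module.finrank ℂ W = m) {z : ExteriorAlgebra ℂ V} (hz : z ∈ wedgePower m W)
    (h0 : z ≠ 0) : wedgePower m W = ℂ ∙ z := by
  symm
  apply Submodule.eq_of_le_of_finrank_eq
  · rwa [Submodule.span_singleton_le_iff_mem]
  · rw [finrank_span_singleton h0, finrank_wedgePower, hW, Nat.choose_self]

/-- Contraction with a functional vanishing on `W` kills `⋀ᵐ W`. -/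
theorem contractLeft_eq_zero_of_mem_wedgePower {m : ℕ} {W : Submodule ℂ V}
    (δ : Module.Dual ℂ V) (hδ : ∀ w ∈ W, δ w = 0) {z : ExteriorAlgebra ℂ V}
    (hz : z ∈ wedgePower m W) : CliffordAlgebra.contractLeft (Q := 0) δ z = 0 := by
  refine Submodule.pow_induction_on_left (W.map (ExteriorAlgebra.ι ℂ))
    (C := fun z => CliffordAlgebra.contractLeft (Q := 0) δ z = 0) ?_ ?_ ?_ hz
  · exact fun r => CliffordAlgebra.contractLeft_algebraMap _ _ _
  · intro x y hx hy
    rw [map_add, hx, hy, add_zero]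
  · rintro _ ⟨w, hw, rfl⟩ y hy
    have := CliffordAlgebra.contractLeft_ι_mul (Q := (0 : QuadraticForm ℂ V)) δ w y
    rw [hδ w hw, hy, zero_smul, mul_zero, sub_zero] at this
    exact this

/-- Contracting v ∧ z with a functional δ that kills W but not v gives δ(v) z. -/
theorem eq_zero_of_ι_mul_eq_zero {m : ℕ} {W : Submodule ℂ V} {v : V} (hv : v ∉ W)
    {z : ExteriorAlgebra ℂ V} (hz : z ∈ wedgePower m W) (h : ExteriorAlgebra.ι ℂ v * z = 0) :
    z = 0 := by
  obtain ⟨δ, hδv, hδ⟩ := Submodule.exists_dual_map_eq_bot_of_notMem hv inferInstance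
  have hδW : ∀ w ∈ W, δ w = 0 := fun w hw =>
    (Submodule.eq_bot_iff _).1 hδ _ (Submodule.mem_map_of_mem hw)
  have := CliffordAlgebra.contractLeft_ι_mul (Q := (0 : QuadraticForm ℂ V)) δ v z
  rw [contractLeft_eq_zero_of_mem_wedgePower δ hδW hz, mul_zero, sub_zero] at this
  erw [h] at this
  rw [map_zero] at this
  exact (smul_eq_zero.1 this.symm).resolve_left hδv

theorem ι_mul_eq_zero_iff [FiniteDimensional ℂ V] {m : ℕ} {W : Submodule ℂ V}
    (hW : Module.finrank ℂ W = m) {z : ExteriorAlgebra ℂ V} (hz : z ∈ wedgePower m W)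
    (h0 : z ≠ 0) (v : V) : ExteriorAlgebra.ι ℂ v * z = 0 ↔ v ∈ W := by
  constructor
  · intro h
    by_contra hv
    exact h0 (eq_zero_of_ι_mul_eq_zero hv hz h)
  · intro hv
    have hb : wedgePower (m + 1) W = ⊥ := by
      rw [← Submodule.finrank_eq_zero (R := ℂ), finrank_wedgePower, hW, Nat.choose_succ_self]
    have := ι_mul_mem_wedgePower hv hz
    rwa [hb, Submodule.mem_bot] at this

/-- Every linear map `W → ⋀ᵐ⁺¹ W` with `dim W = m + 1` is multiplication by an element of `⋀ᵐ A`
for some hyperplane `A ⊆ W`. -/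
theorem exists_wedge_eq_linearMap [FiniteDimensional ℂ V] {m : ℕ} {W : Submodule ℂ V}
    (hW : Module.finrank ℂ W = m + 1) (f : W →ₗ[ℂ] wedgePower (m + 1) W) :
    ∃ A ≤ W, Module.finrank ℂ A = m ∧ ∃ a ∈ wedgePower m A,
      ∀ e : W, (f e : ExteriorAlgebra ℂ V) = ExteriorAlgebra.ι ℂ (e : V) * a := by
  -- The target is a line, so f kills a hyperplane A; multiplication by a generator of ⋀ᵐA kills A
  -- too, and the two maps differ by a scalar.
  have hker : m ≤ Module.finrank ℂ (LinearMap.ker f) := by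
    have h1 := LinearMap.finrank_range_add_finrank_ker f
    have h2 := Submodule.finrank_le (LinearMap.range f)
    rw [finrank_wedgePower, hW, Nat.choose_self] at h2
    omega
  have hA' : ∃ A' ≤ LinearMap.ker f, Module.finrank ℂ A' = m := by
    obtain ⟨g, hg⟩ := exists_linearIndependent_of_le_finrank hker
    refine ⟨(Submodule.span ℂ (Set.range g)).map (LinearMap.ker f).subtype,
      Submodule.map_subtype_le _ _, ?_⟩
    rw [Submodule.finrank_map_subtype_eq, finrank_span_eq_card hg, Fintype.card_fin]
  obtain ⟨A', hA'k, hA'm⟩ := hA'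
  set A : Submodule ℂ V := A'.map W.subtype
  have hAW : A ≤ W := Submodule.map_subtype_le _ _
  have hAm : Module.finrank ℂ A = m := by
    rw [← hA'm]; exact Submodule.finrank_map_subtype_eq W A'
  obtain ⟨e, heW, heA⟩ : ∃ e ∈ W, e ∉ A := by
    by_contra! h
    have := Submodule.finrank_mono (show W ≤ A from h)
    omega
  obtain ⟨a, ha, ha0⟩ := exists_ne_zero_mem_wedgePower hAm.ge
  have hea : ExteriorAlgebra.ι ℂ e * a ≠ 0 := fun h => ha0 (eq_zero_of_ι_mul_eq_zero heA ha h)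
  have hmem := ι_mul_mem_wedgePower heW (wedgePower_mono m hAW ha)
  have hfe := (f ⟨e, heW⟩).2
  obtain ⟨c, hc⟩ := Submodule.mem_span_singleton.1 ((wedgePower_eq_span hW hmem hea).le hfe)
  refine ⟨A, hAW, hAm, c • a, Submodule.smul_mem _ _ ha, ?_⟩
  rintro ⟨w, hw⟩
  have hsup : A ⊔ ℂ ∙ e = W := by
    apply Submodule.eq_of_le_of_finrank_eq
    · exact sup_le hAW ((Submodule.span_singleton_le_iff_mem _ _).2 heW)
    · rw [Submodule.finrank_sup_span_singleton heA, hAm, hW]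
  obtain ⟨u, hu, v, hv, rfl⟩ := Submodule.mem_sup.1 (hsup.ge hw)
  obtain ⟨t, rfl⟩ := Submodule.mem_span_singleton.1 hv
  obtain ⟨u', hu', rfl⟩ := hu
  have hfu : f u' = 0 := hA'k hu'
  have hfw : f ⟨W.subtype u' + t • e, hw⟩ = t • f ⟨e, heW⟩ := by
    have : (⟨W.subtype u' + t • e, hw⟩ : W) = u' + t • ⟨e, heW⟩ := rfl
    rw [this, map_add, map_smul, hfu, zero_add]
  rw [hfw, Submodule.coe_smul, ← hc, map_add, map_smul, add_mul, mul_smul_comm, mul_smul_comm,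
    (ι_mul_eq_zero_iff hAm ha ha0 (W.subtype u')).2 (Submodule.mem_map_of_mem hu'), smul_zero,
    zero_add, smul_mul_assoc, smul_comm]

/-- The pairing `⋀ᵐ W → Hom(W, ⋀ᵐ⁺¹ W)`. -/
def wedgePairing (m : ℕ) (W : Submodule ℂ V) :
    wedgePower m W →ₗ[ℂ] W →ₗ[ℂ] wedgePower (m + 1) W :=
  LinearMap.mk₂ ℂ (fun a e => ⟨ExteriorAlgebra.ι ℂ (e : V) * a, ι_mul_mem_wedgePower e.2 a.2⟩)
    (fun _ _ _ => Subtype.ext (mul_add _ _ _)) (fun _ _ _ => Subtype.ext (mul_smul_comm _ _ _))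
    (fun _ _ _ => Subtype.ext (by simp [add_mul])) (fun _ _ _ => Subtype.ext (by simp))

/-- Surjectivity is `exists_wedge_eq_linearMap`, and both sides have dimension m + 1. -/
theorem wedgePairing_bijective [FiniteDimensional ℂ V] {m : ℕ} {W : Submodule ℂ V}
    (hW : Module.finrank ℂ W = m + 1) : Function.Bijective (wedgePairing m W) := by
  have hs : Function.Surjective (wedgePairing m W) := fun f => by
    obtain ⟨A, hAW, -, a, ha, h⟩ := exists_wedge_eq_linearMap hW f
    exact ⟨⟨a, wedgePower_mono m hAW ha⟩, LinearMap.ext fun e => Subtype.ext (h e).symm⟩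
  have hdim : Module.finrank ℂ (wedgePower m W) =
      Module.finrank ℂ (W →ₗ[ℂ] wedgePower (m + 1) W) := by
    rw [Module.finrank_linearMap, finrank_wedgePower, finrank_wedgePower, hW,
      Nat.choose_self, mul_one, Nat.choose_succ_self_right]
  exact ⟨(LinearMap.injective_iff_surjective_of_finrank_eq_finrank (K := ℂ)
    (V := wedgePower m W) (V₂ := W →ₗ[ℂ] wedgePower (m + 1) W) hdim).2 hs, hs⟩

theorem eq_zero_of_forall_ι_mul_eq_zero [FiniteDimensional ℂ V] {m : ℕ} {W : Submodule ℂ V}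
    (hW : Module.finrank ℂ W = m + 1) {a : ExteriorAlgebra ℂ V} (ha : a ∈ wedgePower m W)
    (h : ∀ e ∈ W, ExteriorAlgebra.ι ℂ e * a = 0) : a = 0 := by
  have : (⟨a, ha⟩ : wedgePower m W) = 0 := (wedgePairing_bijective hW).1 <|
    LinearMap.ext fun e => Subtype.ext <| by rw [map_zero]; exact h e e.2
  exact congrArg Subtype.val this

/-- In codimension one every element of the exterior power is decomposable. -/
theorem exists_hyperplane_mem_wedgePower [FiniteDimensional ℂ V] {m : ℕ} {W : Submodule ℂ V}
    (hW : Module.finrank ℂ W = m + 1) {a : ExteriorAlgebra ℂ V} (ha : a ∈ wedgePower m W) :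
    ∃ A ≤ W, Module.finrank ℂ A = m ∧ a ∈ wedgePower m A := by
  obtain ⟨A, hAW, hAm, b, hb, h⟩ := exists_wedge_eq_linearMap hW (wedgePairing m W ⟨a, ha⟩)
  refine ⟨A, hAW, hAm, ?_⟩
  have : a - b = 0 := eq_zero_of_forall_ι_mul_eq_zero hW
    (sub_mem ha (wedgePower_mono m hAW hb)) fun e he => by
      rw [mul_sub, ← h ⟨e, he⟩, sub_eq_zero]; rfl
  rwa [sub_eq_zero.1 this]

/-- If `x`, `y` and `x + y` represent `k`-dimensional subspaces, `x` representing `W`, and `y` is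
not proportional to `x`, then `y = w ∧ a` with `a ∈ ⋀ᵐ W`. -/
theorem exists_eq_ι_mul_of_add_mem_wedgePower [FiniteDimensional ℂ V] {m : ℕ}
    {W W' W'' : Submodule ℂ V} (hW : Module.finrank ℂ W = m + 1)
    (hW' : Module.finrank ℂ W' = m + 1) (hW'' : Module.finrank ℂ W'' = m + 1)
    {x y : ExteriorAlgebra ℂ V} (hx : x ∈ wedgePower (m + 1) W) (hx0 : x ≠ 0)
    (hy : y ∈ wedgePower (m + 1) W') (hyx : y ∉ wedgePower (m + 1) W)
    (hxy : x + y ∈ wedgePower (m + 1) W'') :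
    ∃ w, ∃ a ∈ wedgePower m W, y = ExteriorAlgebra.ι ℂ w * a := by
  have hy0 : y ≠ 0 := by rintro rfl; exact hyx (zero_mem _)
  have hxy0 : x + y ≠ 0 := fun h => hyx (by
    rw [← neg_eq_of_add_eq_zero_right h]; exact neg_mem hx)
  -- Since v ∧ (x + y) = 0, the vectors v ∧ x and v ∧ y agree up to sign. Every u ∈ W' kills the
  -- latter, hence lies in W + ⟨v⟩.
  obtain ⟨v, hv'', hv⟩ : ∃ v ∈ W'', v ∉ W := by
    by_contra! h
    have hle : W'' ≤ W := h
    have := wedgePower_mono (m + 1) hle hxy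
    exact hyx ((Submodule.add_mem_iff_right _ hx).1 this)
  have hvxy := (ι_mul_eq_zero_iff hW'' hxy hxy0 v).2 hv''
  rw [mul_add] at hvxy
  have hvx : ExteriorAlgebra.ι ℂ v * x ≠ 0 := fun h => hx0 (eq_zero_of_ι_mul_eq_zero hv hx h)
  have hvmem : ∀ U : Submodule ℂ V, v ∈ U ⊔ ℂ ∙ v := fun U =>
    Submodule.mem_sup_right (Submodule.mem_span_singleton_self v)
  have hW'v : W' ≤ W ⊔ ℂ ∙ v := fun u hu => by
    have hdim : Module.finrank ℂ (W ⊔ ℂ ∙ v : Submodule ℂ V) = m + 1 + 1 := by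
      rw [Submodule.finrank_sup_span_singleton hv, hW]
    rw [← ι_mul_eq_zero_iff hdim
      (ι_mul_mem_wedgePower (hvmem W) (wedgePower_mono _ le_sup_left hx)) hvx,
      eq_neg_of_add_eq_zero_left hvxy, mul_neg, neg_eq_zero, ← mul_assoc,
      eq_neg_of_add_eq_zero_left (ExteriorAlgebra.ι_add_mul_swap u v), neg_mul, mul_assoc,
      (ι_mul_eq_zero_iff hW' hy hy0 u).2 hu, mul_zero, neg_zero]
  obtain ⟨w, hw', hw⟩ : ∃ w ∈ W', w ∉ W := by
    by_contra! h
    exact hyx (wedgePower_mono _ (show W' ≤ W from h) hy)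
  have hinf : m ≤ Module.finrank ℂ (W ⊓ W' : Submodule ℂ V) := by
    have h1 := Submodule.finrank_sup_add_finrank_inf_eq W W'
    have h2 := Submodule.finrank_mono (sup_le le_sup_left hW'v : W ⊔ W' ≤ W ⊔ ℂ ∙ v)
    rw [Submodule.finrank_sup_span_singleton hv] at h2
    omega
  obtain ⟨a, ha, ha0⟩ := exists_ne_zero_mem_wedgePower hinf
  have hwa0 : ExteriorAlgebra.ι ℂ w * a ≠ 0 := fun h =>
    ha0 (eq_zero_of_ι_mul_eq_zero (W := W ⊓ W') (fun h => hw h.1) ha h)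
  have hwa := ι_mul_mem_wedgePower hw' (wedgePower_mono m inf_le_right ha)
  rw [wedgePower_eq_span hW' hwa hwa0, Submodule.mem_span_singleton] at hy
  obtain ⟨c, rfl⟩ := hy
  exact ⟨w, c • a, Submodule.smul_mem _ _ (wedgePower_mono m inf_le_left ha),
    (mul_smul_comm _ _ _).symm⟩

/-- The pencil spanned by `e ∧ a` and `f ∧ a` consists of decomposable vectors. -/
theorem exists_mem_wedgePower_of_mem_pencil [FiniteDimensional ℂ V] {m : ℕ} {W : Submodule ℂ V}
    (hW : Module.finrank ℂ W = m + 1) {x a : ExteriorAlgebra ℂ V}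
    (hx : x ∈ wedgePower (m + 1) W) (ha : a ∈ wedgePower m W) (ha0 : a ≠ 0) (f : V) (α β : ℂ)
    (h0 : α • x + β • (ExteriorAlgebra.ι ℂ f * a) ≠ 0) :
    ∃ U : Submodule ℂ V, Module.finrank ℂ U = m + 1 ∧
      α • x + β • (ExteriorAlgebra.ι ℂ f * a) ∈ wedgePower (m + 1) U := by
  obtain ⟨A, hAW, hAm, haA⟩ := exists_hyperplane_mem_wedgePower hW ha
  obtain ⟨e, heW, heA⟩ : ∃ e ∈ W, e ∉ A := by
    by_contra! h
    have := Submodule.finrank_mono (show W ≤ A from h)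
    omega
  have hea : ExteriorAlgebra.ι ℂ e * a ≠ 0 := fun h => ha0 (eq_zero_of_ι_mul_eq_zero heA haA h)
  -- Here x is a multiple of e ∧ a, so the whole pencil consists of vectors g ∧ a with g in the span
  -- of e and f.
  rw [wedgePower_eq_span hW (ι_mul_mem_wedgePower heW ha) hea, Submodule.mem_span_singleton] at hx
  obtain ⟨c, rfl⟩ := hx
  have heq : α • c • (ExteriorAlgebra.ι ℂ e * a) + β • (ExteriorAlgebra.ι ℂ f * a) =
      ExteriorAlgebra.ι ℂ ((α * c) • e + β • f) * a := by
    simp [add_mul, mul_smul]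
  rw [heq] at h0 ⊢
  set g := (α * c) • e + β • f
  have hg : g ∉ A := fun h => h0 ((ι_mul_eq_zero_iff hAm haA ha0 g).2 h)
  exact ⟨A ⊔ ℂ ∙ g, by rw [Submodule.finrank_sup_span_singleton hg, hAm],
    ι_mul_mem_wedgePower (Submodule.mem_sup_right (Submodule.mem_span_singleton_self g))
      (wedgePower_mono m le_sup_left haA)⟩

end ExteriorPowers

/-! ### Lines on the Grassmannian and the Segre variety. -/

section Grassmannian

variable {V : Type*} [AddCommGroup V] [Module ℂ V]

theorem map_subtype_range_exteriorPower_map (k : ℕ) (W : Submodule ℂ V) :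
    (LinearMap.range (exteriorPower.map k W.subtype)).map (⋀[ℂ]^k V).subtype =
      wedgePower k W := by
  have h : (⋀[ℂ]^k V).subtype ∘ₗ exteriorPower.map k W.subtype =
      (ExteriorAlgebra.map W.subtype).toLinearMap ∘ₗ (⋀[ℂ]^k W).subtype := by
    apply exteriorPower.linearMap_ext
    ext v
    simp [exteriorPower.map_apply_ιMulti, ExteriorAlgebra.map_apply_ιMulti]
  rw [← LinearMap.range_comp, h, LinearMap.range_comp, Submodule.range_subtype,
    wedgePower_eq_map_exteriorPower]

theorem mem_range_exteriorPower_map_iff {k : ℕ} {W : Submodule ℂ V} (z : ⋀[ℂ]^k V) :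
    z ∈ LinearMap.range (exteriorPower.map k W.subtype) ↔
      (z : ExteriorAlgebra ℂ V) ∈ wedgePower k W := by
  rw [← map_subtype_range_exteriorPower_map]
  constructor
  · exact fun h => Submodule.mem_map_of_mem h
  · rintro ⟨z', hz', h⟩
    rwa [← Subtype.ext h]

variable [FiniteDimensional ℂ V]

theorem mk_mem_grassmannian_iff {k : ℕ} (z : ⋀[ℂ]^k V) (hz : z ≠ 0) :
    Projectivization.mk ℂ z hz ∈ grassmannian V k ↔ ∃ W : Submodule ℂ V,
      Module.finrank ℂ W = k ∧ (z : ExteriorAlgebra ℂ V) ∈ wedgePower k W := by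
  constructor
  · rintro ⟨⟨W, hW⟩, h⟩
    refine ⟨W, hW, (mem_range_exteriorPower_map_iff z).1 ?_⟩
    have := congrArg Projectivization.submodule h
    rw [pluckerMap, Projectivization.submodule_mk'', Projectivization.submodule_mk] at this
    rw [this]
    exact Submodule.mem_span_singleton_self z
  · rintro ⟨W, hW, h⟩
    refine ⟨⟨W, hW⟩, Projectivization.submodule_injective ?_⟩
    rw [pluckerMap, Projectivization.submodule_mk'', Projectivization.submodule_mk]
    symm
    apply Submodule.eq_of_le_of_finrank_eq
    · rw [Submodule.span_singleton_le_iff_mem]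
      exact (mem_range_exteriorPower_map_iff z).2 h
    · rw [finrank_span_singleton hz, finrank_range_exteriorPower_map W hW]

/-- The bilinear map `(a, v) ↦ v ∧ a` from `⋀ᵐ W × V` to `⋀ᵐ⁺¹ V`. -/
def wedgeBilinear (m : ℕ) (W : Submodule ℂ V) : wedgePower m W →ₗ[ℂ] V →ₗ[ℂ] ⋀[ℂ]^(m + 1) V :=
  LinearMap.mk₂ ℂ (fun a v => ⟨ExteriorAlgebra.ι ℂ v * a,
      wedgePower_le_exteriorPower (m + 1) ⊤
        (ι_mul_mem_wedgePower Submodule.mem_top (wedgePower_mono m le_top a.2))⟩)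
    (fun _ _ _ => Subtype.ext (mul_add _ _ _)) (fun _ _ _ => Subtype.ext (mul_smul_comm _ _ _))
    (fun _ _ _ => Subtype.ext (by simp [add_mul])) (fun _ _ _ => Subtype.ext (by simp))

/-- If `W ∩ F = 0`, then `⋀ᵐ W ⊗ F → ⋀ᵐ⁺¹ V / ⋀ᵐ⁺¹ W` is injective, in coordinates on `F`. -/
theorem eq_zero_of_sum_wedge_mem {m : ℕ} {W F : Submodule ℂ V}
    (hW : Module.finrank ℂ W = m + 1) (hWF : Disjoint W F) {κ : Type*} [Fintype κ] {f : κ → V}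
    (hf : LinearIndependent ℂ f) (hfF : ∀ j, f j ∈ F) {a : κ → ExteriorAlgebra ℂ V}
    (ha : ∀ j, a j ∈ wedgePower m W)
    (h : ∑ j, ExteriorAlgebra.ι ℂ (f j) * a j ∈ wedgePower (m + 1) W) (j : κ) : a j = 0 := by
  obtain ⟨x, hx, hx0⟩ := exists_ne_zero_mem_wedgePower hW.ge
  refine eq_zero_of_forall_ι_mul_eq_zero hW (ha j) fun e he => ?_
  -- Multiplying the sum by e ∈ W kills it and turns each a j into c j • x. Hence ∑ c j • f j lies
  -- in W ∩ F = 0.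
  have hc : ∀ j, ∃ c : ℂ, c • x = ExteriorAlgebra.ι ℂ e * a j := fun j =>
    Submodule.mem_span_singleton.1
      ((wedgePower_eq_span hW hx hx0).le (ι_mul_mem_wedgePower he (ha j)))
  choose c hc using hc
  have h1 : ExteriorAlgebra.ι ℂ e * ∑ j, ExteriorAlgebra.ι ℂ (f j) * a j = 0 := by
    by_cases h0 : ∑ j, ExteriorAlgebra.ι ℂ (f j) * a j = 0
    · rw [h0, mul_zero]
    · exact (ι_mul_eq_zero_iff hW h h0 e).2 he
  have h2 : ExteriorAlgebra.ι ℂ (∑ j, c j • f j) * x = 0 := by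
    rw [← neg_eq_zero, ← h1, map_sum, Finset.sum_mul, Finset.mul_sum, ← Finset.sum_neg_distrib]
    refine Finset.sum_congr rfl fun j _ => ?_
    rw [map_smul, smul_mul_assoc, ← mul_smul_comm, hc, ← mul_assoc, ← mul_assoc,
      eq_neg_of_add_eq_zero_left (ExteriorAlgebra.ι_add_mul_swap e (f j)), neg_mul]
  have h3 : ∑ j, c j • f j = 0 := Submodule.disjoint_def.1 hWF _
    ((ι_mul_eq_zero_iff hW hx hx0 _).1 h2)
    (Submodule.sum_mem _ fun j _ => Submodule.smul_mem _ _ (hfF j))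
  rw [← hc, Fintype.linearIndependent_iff.1 hf c h3 j, zero_smul]

theorem isSegreVariety_baseOfLines_grassmannian {m n : ℕ} (hn : Module.finrank ℂ V = n)
    (x : Projectivization ℂ (⋀[ℂ]^(m + 1) V)) (hxG : x ∈ grassmannian V (m + 1)) :
    IsSegreVariety (m + 1) (n - (m + 1)) (baseOfLines (grassmannian V (m + 1)) x) := by
  induction x with | h x₀ h0 =>
  obtain ⟨W, hW, hx₀W⟩ := (mk_mem_grassmannian_iff x₀ h0).1 hxG
  set x := Projectivization.mk ℂ x₀ h0
  have hx : x.submodule = ℂ ∙ x₀ := rfl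
  have h0' : (x₀ : ExteriorAlgebra ℂ V) ≠ 0 := fun h => h0 (Subtype.ext h)
  have hmem : ∀ z : ⋀[ℂ]^(m + 1) V, z ∈ x.submodule ↔
      (z : ExteriorAlgebra ℂ V) ∈ wedgePower (m + 1) W := fun z => by
    rw [hx, wedgePower_eq_span hW hx₀W h0', Submodule.mem_span_singleton,
      Submodule.mem_span_singleton]
    simp only [Subtype.ext_iff, Submodule.coe_smul]
  -- The complement F stands in for V / W.
  obtain ⟨F, hF⟩ := Submodule.exists_isCompl W
  have hFdim : Module.finrank ℂ F = n - (m + 1) := by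
    have := Submodule.finrank_add_eq_of_isCompl hF
    omega
  let α : (Fin (m + 1) → ℂ) ≃ₗ[ℂ] wedgePower m W := LinearEquiv.ofFinrankEq _ _ (by
    rw [finrank_wedgePower, hW, Nat.choose_succ_self_right, Module.finrank_fin_fun])
  let s : (Fin (n - (m + 1)) → ℂ) ≃ₗ[ℂ] F := LinearEquiv.ofFinrankEq _ _ (by
    rw [hFdim, Module.finrank_fin_fun])
  let θ := tangentEquiv x x₀ hx h0
  let ρ : ((Fin (m + 1) → ℂ) ⊗[ℂ] (Fin (n - (m + 1)) → ℂ)) →ₗ[ℂ] ⋀[ℂ]^(m + 1) V :=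
    TensorProduct.lift ((wedgeBilinear m W).compl₁₂ α.toLinearMap (F.subtype ∘ₗ s.toLinearMap))
  have hρ : ∀ u v, (ρ (u ⊗ₜ v) : ExteriorAlgebra ℂ V) =
      ExteriorAlgebra.ι ℂ (s v : V) * (α u : ExteriorAlgebra ℂ V) := fun u v => rfl
  let σ : ((Fin (m + 1) → ℂ) ⊗[ℂ] (Fin (n - (m + 1)) → ℂ)) →ₗ[ℂ] ProjTangentSpace x :=
    θ.symm.toLinearMap ∘ₗ x.submodule.mkQ ∘ₗ ρ
  have hθσ : ∀ z, θ (σ z) = x.submodule.mkQ (ρ z) := fun z => θ.apply_symm_apply _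
  refine ⟨σ, ?_, ?_⟩
  · rw [← LinearMap.ker_eq_bot, Submodule.eq_bot_iff]
    intro z hz
    have hz' : ρ z ∈ x.submodule := by
      rw [← Submodule.Quotient.mk_eq_zero, ← Submodule.mkQ_apply, ← hθσ, LinearMap.mem_ker.1 hz,
        map_zero]
    obtain ⟨c, rfl⟩ := TensorProduct.eq_repr_basis_right (Pi.basisFun ℂ (Fin (n - (m + 1)))) z
    rw [hmem, Finsupp.sum_fintype _ _ (by simp), map_sum, Submodule.coe_sum] at hz'
    simp only [hρ] at hz'
    have hli : LinearIndependent ℂ fun j =>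
        (s (Pi.basisFun ℂ (Fin (n - (m + 1))) j) : V) :=
      (Pi.basisFun ℂ (Fin (n - (m + 1)))).linearIndependent.map'
        (F.subtype ∘ₗ s.toLinearMap) (LinearMap.ker_eq_bot.2
          (F.injective_subtype.comp s.injective))
    have hc : c = 0 := Finsupp.ext fun j => by
      have := eq_zero_of_sum_wedge_mem hW hF.disjoint hli (fun j => (s _).2)
        (fun j => (α (c j)).2) hz' j
      simpa using this
    rw [hc, Finsupp.sum_zero_index]
  · ext t
    constructor
    · induction t with | h φ hφ =>
      intro ht
      obtain ⟨y, hy⟩ := x.submodule.mkQ_surjective (θ φ)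
      rw [mem_baseOfLines_iff _ x x₀ hx h0 φ hφ y hy.symm] at ht
      have hyx : y ∉ x.submodule := fun h => by
        rw [Submodule.mkQ_apply, (Submodule.Quotient.mk_eq_zero _).2 h] at hy
        exact hφ (θ.map_eq_zero_iff.1 hy.symm)
      have hdec : ∀ z ∈ Submodule.span ℂ {x₀, y}, z ≠ 0 → ∃ U : Submodule ℂ V,
          Module.finrank ℂ U = m + 1 ∧ (z : ExteriorAlgebra ℂ V) ∈ wedgePower (m + 1) U :=
        fun z hz hz0 => (mk_mem_grassmannian_iff z hz0).1 <| ht _ <| by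
          rwa [Projectivization.submodule_mk, Submodule.span_singleton_le_iff_mem]
      obtain ⟨W', hW', hyW'⟩ := hdec y (Submodule.subset_span (by simp))
        (by rintro rfl; exact hyx (zero_mem _))
      obtain ⟨W'', hW'', hyW''⟩ := hdec (x₀ + y)
        (add_mem (Submodule.subset_span (by simp)) (Submodule.subset_span (by simp)))
        (fun h => hyx (by
          rw [← neg_eq_of_add_eq_zero_right h, hx]
          exact neg_mem (Submodule.mem_span_singleton_self x₀)))
      obtain ⟨w, a, ha, hya⟩ := exists_eq_ι_mul_of_add_mem_wedgePower hW hW' hW'' hx₀W h0' hyW'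
        (fun h => hyx ((hmem y).2 h)) hyW''
      -- The W-component w₁ contributes w₁ ∧ a ∈ ⋀ᵐ⁺¹W, which vanishes modulo x.
      obtain ⟨w₁, hw₁, f, hf, rfl⟩ := Submodule.mem_sup.1
        (hF.sup_eq_top.ge (Submodule.mem_top (x := w)))
      have hφσ : φ = σ (α.symm ⟨a, ha⟩ ⊗ₜ s.symm ⟨f, hf⟩) := by
        apply θ.injective
        rw [hθσ, ← hy, Submodule.mkQ_apply, Submodule.mkQ_apply, Submodule.Quotient.eq, hmem,
          Submodule.coe_sub, hρ, hya, LinearEquiv.apply_symm_apply, LinearEquiv.apply_symm_apply,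
          ← sub_mul, ← map_sub, add_sub_cancel_right]
        exact ι_mul_mem_wedgePower hw₁ ha
      refine ⟨α.symm ⟨a, ha⟩, s.symm ⟨f, hf⟩, ?_, ?_, by rw [← hφσ]; rfl⟩
      · intro h
        rw [h, TensorProduct.zero_tmul, map_zero] at hφσ
        exact hφ hφσ
      · intro h
        rw [h, TensorProduct.tmul_zero, map_zero] at hφσ
        exact hφ hφσ
    · rintro ⟨u, v, hu, -, ht⟩
      have hσ0 : σ (u ⊗ₜ v) ≠ 0 := fun h => by
        have := t.finrank_submodule
        rw [ht, h, Submodule.span_zero_singleton, finrank_bot] at this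
        exact zero_ne_one this
      have htm : t = Projectivization.mk ℂ (σ (u ⊗ₜ v)) hσ0 :=
        Projectivization.submodule_injective ht
      rw [htm, mem_baseOfLines_iff _ x x₀ hx h0 _ hσ0 _ (hθσ _)]
      intro p hp
      induction p with | h z hz =>
      rw [Projectivization.submodule_mk, Submodule.span_singleton_le_iff_mem,
        Submodule.mem_span_pair] at hp
      obtain ⟨c, c', rfl⟩ := hp
      rw [mk_mem_grassmannian_iff]
      have hz' : c • (x₀ : ExteriorAlgebra ℂ V) + c' • (ExteriorAlgebra.ι ℂ (s v : V) *
          (α u : ExteriorAlgebra ℂ V)) ≠ 0 := fun h => hz (Subtype.ext h)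
      exact exists_mem_wedgePower_of_mem_pencil hW hx₀W (α u).2
        (fun h => hu (α.map_eq_zero_iff.1 (Subtype.ext h))) _ c c' hz'

end Grassmannian

end

/-! ### Assembling the Grassmannian and the hypersurfaces. -/

theorem mainTheorem8 {V : Type*} [AddCommGroup V] [Module ℂ V] [FiniteDimensional ℂ V]
    (n k : ℕ) (hn : Module.finrank ℂ V = n) (hk : 1 ≤ k) (hkn : k ≤ n)
    (l : ℕ) (d : Fin l → ℕ) (Y : Fin l → Set (Projectivization ℂ (⋀[ℂ]^k V)))
    (hY : ∀ i, IsHypersurface (d i) (Y i))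
    (X : Set (Projectivization ℂ (⋀[ℂ]^k V))) (hX : X = grassmannian V k ∩ ⋂ i, Y i)
    (x : Projectivization ℂ (⋀[ℂ]^k V)) (hx : x ∈ X) :
    IsSegreVariety k (n - k) (baseOfLines (grassmannian V k) x) ∧
    ∃ (e : Fin (∑ i, d i) → ℕ)
      (H : Fin (∑ i, d i) → Set (Projectivization ℂ (ProjTangentSpace x))),
      (∀ j, IsHypersurface (e j) (H j) ∧ e j ≤ Finset.univ.sup d) ∧
      baseOfLines X x = baseOfLines (grassmannian V k) x ∩ ⋂ j, H j := by
  subst hX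
  constructor
  · obtain ⟨m, rfl⟩ := Nat.exists_eq_add_of_le' hk
    exact isSegreVariety_baseOfLines_grassmannian hn x hx.1
  · choose e H heH hB using fun i =>
      exists_hypersurfaces_baseOfLines (Y i) (d i) (hY i) x (Set.mem_iInter.1 hx.2 i)
    -- The d i hypersurfaces of each Y i are listed in one family of length ∑ d i.
    let q : (i : Fin l) × Fin (d i) ≃ Fin (∑ i, d i) := finSigmaFinEquiv
    refine ⟨fun j => e (q.symm j).1 (q.symm j).2, fun j => H (q.symm j).1 (q.symm j).2,
      fun j => ⟨(heH _ _).1, (heH _ _).2.trans (Finset.le_sup (Finset.mem_univ _))⟩, ?_⟩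
    rw [baseOfLines_inter, baseOfLines_iInter]
    congr 1
    simp only [hB]
    rw [Set.iInter_sigma' (fun i j => H i j)]
    exact (q.symm.surjective.iInter_comp fun p : (i : Fin l) × Fin (d i) => H p.1 p.2).symm
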